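/- Let $\ell\ge 1$ and $N\ge 0$ be integers and let $q$ be a prime power. For an integer $M\ge 0$ put $X(\ell,M)=\{x=(x_0,\dots,x_{\ell-1})\in(\mathbb Z_{\ge0})^\ell : |x|\le M\}$, where $|x|=\sum_r x_r$. For a finite sequence $m$ of nonnegative integers let $\binom{M}{m}=\frac{M!}{(M-|m|)!\,\prod_r m_r!}$ if $|m|\le M$ and $\binom{M}{m}=0$ otherwise. Let $(a)_k=a(a+1)\cdots(a+k-1)$, $(a)_0=1$, and define the Krawtchouk polynomials $$K_n(x;p;M)=\sum_{k=0}^n\frac{(-n)_k(-x)_k}{(-M)_k\,k!\,p^k}$$ and, for $n,x\in X(\ell,M)$ and $\boldsymbol p=(p_0,\dots,p_{\ell-1})$, $$K_n^{\langle\ell\rangle}(x;\boldsymbol p;M)=\frac1{(-M)_{|n|}}\prod_{r=0}^{\ell-1}(-M_r)_{n_r}K_{n_r}(x_r;p_r;M_r),\qquad M_r=M-\sum_{s<r}x_s-\sum_{s>r}n_s ,$$ the product being $0$ if $n_r>M_r$ for some $r$. Write $K_n^{\langle\ell\rangle}(x;p;M)$ if all $p_r=p$, and $x+ae_0=(x_0+a,x_1,\dots,x_{\ell-1})$.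 Let $n\in X(\ell,N)$, $0\le t\le N$, $u\in X(\ell,N)$ with $t\le u_0$, and $y\in X(\ell,t)$; if $q=2$, assume moreover $y_0=0$. Then $$K_n^{\langle\ell\rangle}\!\left(u+y-te_0;\tfrac{q-1}q;N\right)=\frac1{\binom Nn}\sum_{\alpha}\sum_{z=0}^{\alpha_0}\left(\frac{q(q-2)}{(q-1)^2}\right)^{n_0-\alpha_0}\frac1{(q-1)^{2z}}\binom{t}{n-\alpha,\,z}\binom{N-t}{\alpha-ze_0}\,K^{\langle\ell\rangle}_{\alpha-ze_0}\!\left(u-te_0;\tfrac{q-1}q;N-t\right)K^{\langle\ell\rangle}_{n-\alpha}\!\left(y;\left(\tfrac{q-2}{q-1},\tfrac{q-1}q,\dots,\tfrac{q-1}q\right);t\right),$$ where $\alpha$ runs over all elements of $X(\ell,N)$ with $\alpha_r\le n_r$ for every $r$, and $(n-\alpha,z)$ denotes the sequence $(n_0-\alpha_0,\dots,n_{\ell-1}-\alpha_{\ell-1},z)$. Here $0^0=1$, a term in which a multinomial coefficient is $0$ is read as $0$, and if $q=2$ a term with $n_0>\alpha_0$ is read as $0$ while in a term with $n_0=\alpha_0$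 the factor $K_0(y_0;0;\cdot)$ is read as $1$. -/

import Mathlib

/-- The Pochhammer symbol `(a)_k = a (a + 1) ⋯ (a + k - 1)`. -/
noncomputable def poch (a : ℝ) (k : ℕ) : ℝ := (ascPochhammer ℝ k).eval a

/-- The index set `X(ℓ, N)` of all `x = (x_0, …, x_{ℓ-1})` of natural numbers with `|x| ≤ N`.
The bound `x_r ≤ N` on the entries follows from `|x| ≤ N` and only serves to get a `Finset`. -/
def X (ℓ N : ℕ) : Finset (Fin ℓ → ℕ) :=
  (Fintype.piFinset fun _ => Finset.range (N + 1)).filter fun x => ∑ r, x r ≤ N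

theorem mem_X {ℓ N : ℕ} {x : Fin ℓ → ℕ} : x ∈ X ℓ N ↔ ∑ r, x r ≤ N := by
  simp only [X, Finset.mem_filter, Fintype.mem_piFinset, Finset.mem_range, and_iff_right_iff_imp]
  intro h r
  have := Finset.single_le_sum (f := x) (fun _ _ => Nat.zero_le _) (Finset.mem_univ r)
  omega

/-- The multinomial coefficient `N! / ((N - |m|)! ∏ m_r!)`, which is `0` if `|m| > N`. -/
noncomputable def multinom {k : ℕ} (N : ℕ) (m : Fin k → ℕ) : ℝ :=
  if ∑ r, m r ≤ N then
    (N.factorial : ℝ) / (((N - ∑ r, m r).factorial : ℝ) * ∏ r, ((m r).factorial : ℝ))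
  else 0

/-- The one-variable Krawtchouk polynomial
`K_n(x; p; N) = ∑_{k=0}^n (-n)_k (-x)_k / ((-N)_k k! p^k)`. -/
noncomputable def krawtchouk (n : ℕ) (x p N : ℝ) : ℝ :=
  ∑ k ∈ Finset.range (n + 1),
    poch (-(n : ℝ)) k * poch (-x) k / (poch (-N) k * (k.factorial : ℝ) * p ^ k)

/-- The shifted size `N_r = N - (x_0 + ⋯ + x_{r-1}) - (n_{r+1} + ⋯ + n_{ℓ-1})`, a possibly
negative integer, taken as a real number. -/
def shiftedSize {ℓ : ℕ} (n x : Fin ℓ → ℕ) (N : ℕ) (r : Fin ℓ) : ℝ :=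
  (N : ℝ) - ∑ s ∈ Finset.Iio r, (x s : ℝ) - ∑ s ∈ Finset.Ioi r, (n s : ℝ)

/-- The `ℓ`-variate Krawtchouk polynomial
`K_n^{⟨ℓ⟩}(x; p; N) = (1 / (-N)_{|n|}) ∏_r (-N_r)_{n_r} K_{n_r}(x_r; p_r; N_r)` for `n, x ∈ X(ℓ, N)`.

If `n_r > N_r` for some `r`, take the largest such `r`: there `0 ≤ N_r < n_r` and `x_r ≤ N_r`, so
that `(-N_r)_{n_r} = 0` and the product is `0`. This is also its value when each
`(-N_r)_{n_r} / (-N_r)_k` with `k ≤ n_r` is read as the polynomial `(k - N_r)_{n_r - k}`, so a zero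
denominator `(-N_r)_k` in `krawtchouk` causes no ambiguity. -/
noncomputable def mvKrawtchouk {ℓ : ℕ} (n x : Fin ℓ → ℕ) (p : Fin ℓ → ℝ) (N : ℕ) : ℝ :=
  1 / poch (-(N : ℝ)) (∑ r, n r) *
    ∏ r, (poch (-shiftedSize n x N r) (n r) *
      krawtchouk (n r) (x r : ℝ) (p r) (shiftedSize n x N r))

/-- The sequence `a e_0 = (a, 0, …, 0)`. -/
def e0 {ℓ : ℕ} [NeZero ℓ] (a : ℕ) : Fin ℓ → ℕ := Pi.single 0 a

/-! After normalisation, `C_n(x; p; N) = (N choose n) K_n(x; p; N)` is the coefficient of `X ^ n` in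
`(1 + (1 - 1 / p) X) ^ x (1 + X) ^ (N - x)`, so that it turns sums in `(x, N)` into convolutions in
`n`. Splitting off coordinate `0` carries this over to `ℓ` variables, where it is applied to
`(u - t e_0, N - t)` and `(y, t)`. Only the first univariate factor of the second polynomial
involves `p_0`; replacing `p_0` by `a` in it amounts to the expansion
`C_n(x; p; M) = ∑ i, (a / p) ^ i (1 - a / p) ^ (n - i) (M - i choose n - i) C_i(x; a; M)`.
For `p_0 = (q - 1) / q` and `a = (q - 2) / (q - 1)` one has `a / p_0 = q (q - 2) / (q - 1) ^ 2` and
`1 - a / p_0 = 1 / (q - 1) ^ 2`. -/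

theorem poch_neg_natCast (a k : ℕ) :
    poch (-(a : ℝ)) k = (-1) ^ k * (a.descFactorial k : ℝ) := by
  rw [poch, ascPochhammer_eval_neg_eq_descPochhammer, descPochhammer_eval_eq_descFactorial]

/-- The normalised Krawtchouk polynomial `(-1)^n (-N)_n / n! * K_n(x; p; N)`, which for natural `N`
is `(N choose n) * K_n(x; p; N)`; in this form sums in `(x, N)` become convolutions in `n`. The size
`N` is real so that it can be a `shiftedSize`. -/
noncomputable def krawtchoukCoeff (n : ℕ) (x p N : ℝ) : ℝ :=
  (-1) ^ n / (n.factorial : ℝ) * (poch (-N) n * krawtchouk n x p N)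

theorem krawtchoukCoeff_eq_zero_of_lt {n M : ℕ} (h : M < n) (x p : ℝ) :
    krawtchoukCoeff n x p M = 0 := by
  simp [krawtchoukCoeff, poch_neg_natCast, Nat.descFactorial_eq_zero_iff_lt.2 h]

theorem krawtchouk_summand_eq {n k M : ℕ} (hkn : k ≤ n) (hnM : n ≤ M) (x : ℕ) (p : ℝ) :
    (-1) ^ n / (n.factorial : ℝ) * (poch (-(M : ℝ)) n *
        (poch (-(n : ℝ)) k * poch (-(x : ℝ)) k /
          (poch (-(M : ℝ)) k * (k.factorial : ℝ) * p ^ k))) =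
      x.choose k * (-1 / p) ^ k * (M - k).choose (n - k) := by
  have hMk : (M.choose k : ℝ) ≠ 0 := mod_cast (Nat.choose_pos (hkn.trans hnM)).ne'
  have hchoose : ((M - k).choose (n - k) : ℝ) = M.choose n * n.choose k / M.choose k := by
    rw [eq_div_iff hMk, mul_comm]
    exact_mod_cast (Nat.choose_mul hkn).symm
  have hsign : ((-1 : ℝ) ^ n) * (-1) ^ n = 1 := pow_mul_pow_eq_one n (by norm_num)
  have hinv : (-1 / p) ^ k = (-1) ^ k * (p ^ k)⁻¹ := by rw [div_pow, div_eq_mul_inv]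
  simp only [poch_neg_natCast, Nat.descFactorial_eq_factorial_mul_choose, Nat.cast_mul, hchoose,
    hinv]
  rw [div_eq_mul_inv _ (_ * p ^ k), mul_inv]
  field_simp
  linear_combination (M.choose n * n.choose k * x.choose k * (p ^ k)⁻¹ : ℝ) * hsign

theorem krawtchoukCoeff_eq_sum {x M : ℕ} (hx : x ≤ M) (n : ℕ) (p : ℝ) :
    krawtchoukCoeff n x p M = ∑ k ∈ Finset.range (n + 1),
      (x.choose k : ℝ) * (-1 / p) ^ k * (M - k).choose (n - k) := by
  rcases le_or_gt n M with hnM | hMn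
  · rw [krawtchoukCoeff, krawtchouk, Finset.mul_sum, Finset.mul_sum]
    refine Finset.sum_congr rfl fun k hk => ?_
    exact krawtchouk_summand_eq (Finset.mem_range_succ_iff.1 hk) hnM x p
  · rw [krawtchoukCoeff_eq_zero_of_lt hMn]
    refine (Finset.sum_eq_zero fun k _ => ?_).symm
    rcases le_or_gt k x with hkx | hxk
    · rw [Nat.choose_eq_zero_of_lt (show M - k < n - k by omega), Nat.cast_zero, mul_zero]
    · rw [Nat.choose_eq_zero_of_lt hxk, Nat.cast_zero, zero_mul, zero_mul]

theorem krawtchoukCoeff_eq_coeff {x M : ℕ} (hx : x ≤ M) (n : ℕ) (p : ℝ) :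
    krawtchoukCoeff n x p M =
      ((1 + Polynomial.C (1 - 1 / p) * Polynomial.X) ^ x *
        (1 + Polynomial.X) ^ (M - x)).coeff n := by
  have hlin : 1 + Polynomial.C (1 - 1 / p) * Polynomial.X =
      Polynomial.C (-1 / p) * Polynomial.X + (1 + Polynomial.X) := by
    rw [neg_div, Polynomial.C_sub, Polynomial.C_neg, Polynomial.C_1]
    ring
  have hexpand : (1 + Polynomial.C (1 - 1 / p) * Polynomial.X) ^ x *
      (1 + Polynomial.X) ^ (M - x) = ∑ k ∈ Finset.range (x + 1),
        Polynomial.C (x.choose k * (-1 / p) ^ k) *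
          (Polynomial.X ^ k * (1 + Polynomial.X) ^ (M - k)) := by
    rw [hlin, add_pow, Finset.sum_mul]
    refine Finset.sum_congr rfl fun k hk => ?_
    have hkx := Finset.mem_range_succ_iff.1 hk
    rw [show M - k = (x - k) + (M - x) by omega, pow_add]
    simp only [Polynomial.C_mul, Polynomial.C_pow, map_natCast]
    ring
  simp only [hexpand, krawtchoukCoeff_eq_sum hx, Polynomial.finsetSum_coeff, Polynomial.coeff_C_mul,
    Polynomial.coeff_X_pow_mul', Polynomial.coeff_one_add_X_pow, mul_ite, mul_zero]
  rw [← Finset.sum_filter]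
  refine (Finset.sum_subset (fun k hk => ?_) fun k hk hkx => ?_).symm
  · simp only [Finset.mem_filter, Finset.mem_range] at hk ⊢
    omega
  · simp only [Finset.mem_filter, Finset.mem_range] at hk hkx
    rw [Nat.choose_eq_zero_of_lt (show x < k by omega), Nat.cast_zero, zero_mul, zero_mul]

theorem krawtchoukCoeff_add {x y M N : ℕ} (hx : x ≤ M) (hy : y ≤ N) (n : ℕ) (p : ℝ) :
    ∑ j ∈ Finset.range (n + 1), krawtchoukCoeff j x p M * krawtchoukCoeff (n - j) y p N =
      krawtchoukCoeff n (x + y : ℕ) p (M + N : ℕ) := by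
  simp only [krawtchoukCoeff_eq_coeff hx, krawtchoukCoeff_eq_coeff hy,
    krawtchoukCoeff_eq_coeff (add_le_add hx hy)]
  rw [← Finset.Nat.sum_antidiagonal_eq_sum_range_succ fun i j =>
    Polynomial.coeff _ i * Polynomial.coeff _ j, ← Polynomial.coeff_mul,
    show M + N - (x + y) = (M - x) + (N - y) by omega, pow_add, pow_add]
  congr 1
  ring

theorem sum_choose_mul_choose_mul_pow (A m : ℕ) (c d : ℝ) :
    ∑ j ∈ Finset.range (m + 1),
        d ^ j * c ^ (m - j) * ((A - j).choose (m - j) * A.choose j : ℝ) =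
      (d + c) ^ m * A.choose m := by
  rw [add_pow, Finset.sum_mul]
  refine Finset.sum_congr rfl fun j hj => ?_
  have := Nat.choose_mul (n := A) (Finset.mem_range_succ_iff.1 hj)
  rw [mul_assoc (d ^ j * c ^ (m - j)), mul_comm ((A - j).choose _ : ℝ), mul_comm (m.choose j : ℝ)]
  exact_mod_cast congrArg (fun b : ℕ => d ^ j * c ^ (m - j) * (b : ℝ)) this.symm

theorem krawtchoukCoeff_change_param {x M : ℕ} (hx : x ≤ M) {p a : ℝ} (hp : p ≠ 0)
    (ha : a = 0 → x = 0) (n : ℕ) :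
    krawtchoukCoeff n x p M = ∑ i ∈ Finset.range (n + 1),
      (a / p) ^ i * (1 - a / p) ^ (n - i) *
        ((M - i).choose (n - i) * krawtchoukCoeff i x a M) := by
  -- For `a = 0` the powers of `-1 / a` are junk, but `x.choose k` then vanishes for `k ≠ 0`.
  have hscale (k : ℕ) : (a / p) ^ k * (x.choose k * (-1 / a) ^ k) = x.choose k * (-1 / p) ^ k := by
    rcases eq_or_ne a 0 with h0 | h0
    · rw [ha h0]
      cases k <;> simp
    · rw [mul_left_comm, ← mul_pow]
      congr 2
      field_simp
  let f (k j : ℕ) : ℝ := x.choose k * (-1 / p) ^ k *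
    ((a / p) ^ j * (1 - a / p) ^ (n - k - j) *
      ((M - k - j).choose (n - k - j) * (M - k).choose j))
  calc krawtchoukCoeff n x p M
      = ∑ k ∈ Finset.range (n + 1), ∑ j ∈ Finset.range (n + 1 - k), f k j := by
        rw [krawtchoukCoeff_eq_sum hx]
        refine Finset.sum_congr rfl fun k hk => ?_
        rw [← Finset.mul_sum, Nat.sub_add_comm (Finset.mem_range_succ_iff.1 hk),
          sum_choose_mul_choose_mul_pow, add_sub_cancel, one_pow, one_mul]
    _ = ∑ i ∈ Finset.range (n + 1), ∑ k ∈ Finset.range (i + 1), f k (i - k) :=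
        (Finset.sum_range_diag_flip (n + 1) f).symm
    _ = _ := by
        refine Finset.sum_congr rfl fun i _ => ?_
        rw [krawtchoukCoeff_eq_sum hx, Finset.mul_sum, Finset.mul_sum]
        refine Finset.sum_congr rfl fun k hk => ?_
        obtain ⟨j, rfl⟩ := Nat.exists_eq_add_of_le (Finset.mem_range_succ_iff.1 hk)
        simp only [f, ← hscale, Nat.sub_sub, Nat.add_sub_cancel_left, pow_add]
        ring

theorem sum_eq_head_add_sum_tail {ℓ : ℕ} (x : Fin (ℓ + 1) → ℕ) :
    ∑ r, x r = x 0 + ∑ r, Fin.tail x r :=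
  Fin.sum_univ_succ x

theorem shiftedSize_zero {ℓ : ℕ} (n x : Fin (ℓ + 1) → ℕ) (N : ℕ) :
    shiftedSize n x N 0 = N - ∑ r, (Fin.tail n r : ℝ) := by
  have hIio : Finset.Iio (0 : Fin (ℓ + 1)) = ∅ := Finset.Iio_bot
  rw [shiftedSize, Fin.sum_Ioi_zero, hIio, Finset.sum_empty, sub_zero]
  rfl

theorem sum_Iio_succ {ℓ : ℕ} {M : Type*} [AddCommMonoid M] (f : Fin (ℓ + 1) → M) (r : Fin ℓ) :
    ∑ s ∈ Finset.Iio r.succ, f s = f 0 + ∑ s ∈ Finset.Iio r, f s.succ := by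
  simp only [← Finset.filter_gt_eq_Iio, Finset.sum_filter, Fin.sum_univ_succ, Fin.succ_pos,
    Fin.succ_lt_succ_iff, if_true]

theorem shiftedSize_succ {ℓ : ℕ} (n : Fin (ℓ + 1) → ℕ) {x : Fin (ℓ + 1) → ℕ} {N : ℕ}
    (hx : x 0 ≤ N) (r : Fin ℓ) :
    shiftedSize n x N r.succ = shiftedSize (Fin.tail n) (Fin.tail x) (N - x 0) r := by
  rw [shiftedSize, shiftedSize, sum_Iio_succ, Fin.sum_Ioi_succ, Nat.cast_sub hx, ← sub_sub]
  rfl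

/-- The normalised `ℓ`-variate Krawtchouk polynomial, equal to `multinom N n * mvKrawtchouk n x p N`
if `|x| ≤ N`. It is written as a product of univariate ones so that coordinate `0` can be split
off in inductions on `ℓ`. -/
noncomputable def mvKrawtchoukCoeff {ℓ : ℕ} (n x : Fin ℓ → ℕ) (p : Fin ℓ → ℝ) (N : ℕ) : ℝ :=
  ∏ r, krawtchoukCoeff (n r) (x r) (p r) (shiftedSize n x N r)

theorem mvKrawtchoukCoeff_succ {ℓ : ℕ} (n : Fin (ℓ + 1) → ℕ) {x : Fin (ℓ + 1) → ℕ}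
    (p : Fin (ℓ + 1) → ℝ) {N : ℕ} (hx : x 0 ≤ N) :
    mvKrawtchoukCoeff n x p N =
      krawtchoukCoeff (n 0) (x 0) (p 0) (N - ∑ r, (Fin.tail n r : ℝ)) *
        mvKrawtchoukCoeff (Fin.tail n) (Fin.tail x) (Fin.tail p) (N - x 0) := by
  rw [mvKrawtchoukCoeff, Fin.prod_univ_succ, shiftedSize_zero]
  simp only [shiftedSize_succ n hx]
  rfl

theorem mvKrawtchoukCoeff_eq_zero_of_lt {ℓ : ℕ} {n x : Fin ℓ → ℕ} (p : Fin ℓ → ℝ) {N : ℕ}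
    (hx : ∑ r, x r ≤ N) (hn : N < ∑ r, n r) : mvKrawtchoukCoeff n x p N = 0 := by
  induction ℓ generalizing N with
  | zero => simp at hn
  | succ ℓ ih =>
    rw [sum_eq_head_add_sum_tail] at hx hn
    rw [mvKrawtchoukCoeff_succ n p (by omega)]
    rcases le_or_gt (∑ r, Fin.tail n r) (N - x 0) with htail | htail
    · rw [← Nat.cast_sum, ← Nat.cast_sub (by omega),
        krawtchoukCoeff_eq_zero_of_lt (by omega), zero_mul]
    · rw [ih _ (by omega) htail, mul_zero]

theorem mvKrawtchoukCoeff_succ_of_sum_le {ℓ : ℕ} (n : Fin (ℓ + 1) → ℕ) {x : Fin (ℓ + 1) → ℕ}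
    (p : Fin (ℓ + 1) → ℝ) {N : ℕ} (hx : ∑ r, x r ≤ N) :
    mvKrawtchoukCoeff n x p N =
      krawtchoukCoeff (n 0) (x 0) (p 0) (N - ∑ r, Fin.tail n r : ℕ) *
        mvKrawtchoukCoeff (Fin.tail n) (Fin.tail x) (Fin.tail p) (N - x 0) := by
  rw [sum_eq_head_add_sum_tail] at hx
  rw [mvKrawtchoukCoeff_succ n p (by omega)]
  rcases le_or_gt (∑ r, Fin.tail n r) N with hn | hn
  · rw [Nat.cast_sub hn, Nat.cast_sum]
  · rw [mvKrawtchoukCoeff_eq_zero_of_lt _ (by omega) (by omega), mul_zero, mul_zero]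

theorem sum_Iic_eq_sum_sum_cons {ℓ : ℕ} {M : Type*} [AddCommMonoid M] (n : Fin (ℓ + 1) → ℕ)
    (f : (Fin (ℓ + 1) → ℕ) → M) :
    ∑ m ∈ Finset.Iic n, f m =
      ∑ m ∈ Finset.Iic (Fin.tail n), ∑ k ∈ Finset.range (n 0 + 1), f (Fin.cons k m) := by
  rw [← Finset.sum_product']
  refine Finset.sum_nbij' (fun m => (Fin.tail m, m 0)) (fun a => Fin.cons a.2 a.1)
    ?_ ?_ ?_ ?_ ?_ <;>
  simp +contextual [Pi.le_def, Fin.forall_fin_succ, Fin.tail]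

theorem mvKrawtchoukCoeff_add {ℓ : ℕ} {x y : Fin ℓ → ℕ} {M N : ℕ} (hx : ∑ r, x r ≤ M)
    (hy : ∑ r, y r ≤ N) (n : Fin ℓ → ℕ) (p : Fin ℓ → ℝ) :
    ∑ m ∈ Finset.Iic n, mvKrawtchoukCoeff m x p M * mvKrawtchoukCoeff (n - m) y p N =
      mvKrawtchoukCoeff n (x + y) p (M + N) := by
  induction ℓ generalizing M N with
  | zero =>
    have hIic : Finset.Iic n = {n} := Finset.eq_singleton_iff_unique_mem.2
      ⟨Finset.mem_Iic.2 le_rfl, fun m _ => Subsingleton.elim m n⟩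
    simp [mvKrawtchoukCoeff, hIic]
  | succ ℓ ih =>
    have hxy : ∑ r, (x + y) r ≤ M + N := by
      simpa only [Pi.add_apply, Finset.sum_add_distrib] using add_le_add hx hy
    have htail_add : Fin.tail (x + y) = Fin.tail x + Fin.tail y := rfl
    have htail_sub (k : ℕ) (m : Fin ℓ → ℕ) : Fin.tail (n - Fin.cons k m : Fin (ℓ + 1) → ℕ) =
      Fin.tail n - m := rfl
    rw [mvKrawtchoukCoeff_succ_of_sum_le n p hxy, sum_Iic_eq_sum_sum_cons]
    simp only [mvKrawtchoukCoeff_succ_of_sum_le _ p hx, mvKrawtchoukCoeff_succ_of_sum_le _ p hy,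
      Pi.sub_apply, Fin.cons_zero, Fin.tail_cons, htail_sub]
    rw [sum_eq_head_add_sum_tail] at hx hy
    rw [htail_add, Pi.add_apply, show M + N - (x 0 + y 0) = M - x 0 + (N - y 0) by omega,
      ← ih (by omega) (by omega), Finset.mul_sum]
    refine Finset.sum_congr rfl fun m hm => ?_
    have hsum : ∑ r, m r + ∑ r, (Fin.tail n - m) r = ∑ r, Fin.tail n r := by
      rw [← Finset.sum_add_distrib]
      exact Finset.sum_congr rfl fun r _ => add_tsub_cancel_of_le (Finset.mem_Iic.1 hm r)
    simp only [mul_mul_mul_comm (krawtchoukCoeff _ _ _ _), ← Finset.sum_mul]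
    rcases lt_or_ge (M - x 0) (∑ r, m r) with hmx | hmx
    · rw [mvKrawtchoukCoeff_eq_zero_of_lt _ (by omega) hmx, zero_mul, mul_zero, mul_zero]
    rcases lt_or_ge (N - y 0) (∑ r, (Fin.tail n - m) r) with hmy | hmy
    · rw [mvKrawtchoukCoeff_eq_zero_of_lt _ (by omega) hmy, mul_zero, mul_zero, mul_zero]
    simp only [Pi.sub_apply] at hsum hmy ⊢
    rw [krawtchoukCoeff_add (by omega) (by omega)]
    congr 3
    omega

theorem multinom_eq_descFactorial_div {k : ℕ} (N : ℕ) (m : Fin k → ℕ) :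
    multinom N m = N.descFactorial (∑ r, m r) / ∏ r, ((m r).factorial : ℝ) := by
  rw [multinom]
  split_ifs with h
  · rw [← Nat.factorial_mul_descFactorial h, Nat.cast_mul,
      mul_div_mul_left _ _ (Nat.cast_ne_zero.2 (Nat.factorial_ne_zero _))]
  · rw [Nat.descFactorial_eq_zero_iff_lt.2 (not_le.1 h), Nat.cast_zero, zero_div]

theorem multinom_ne_zero {k N : ℕ} {m : Fin k → ℕ} (h : ∑ r, m r ≤ N) : multinom N m ≠ 0 := by
  rw [multinom_eq_descFactorial_div]
  have := (Nat.descFactorial_pos.2 h).ne'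
  have := fun r => (m r).factorial_ne_zero
  simp [Finset.prod_eq_zero_iff, *]

theorem multinom_snoc {k : ℕ} (N : ℕ) (m : Fin k → ℕ) (z : ℕ) :
    multinom N (Fin.snoc m z : Fin (k + 1) → ℕ) =
      multinom N m * (N - ∑ r, m r).choose z := by
  have hdesc : N.descFactorial (∑ r, m r + z) =
      z.factorial * (N - ∑ r, m r).choose z * N.descFactorial (∑ r, m r) := by
    rw [← Nat.descFactorial_mul_descFactorial (Nat.le_add_right _ z), Nat.add_sub_cancel_left,
      Nat.descFactorial_eq_factorial_mul_choose]
  simp only [multinom_eq_descFactorial_div, Fin.sum_univ_castSucc, Fin.prod_univ_castSucc,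
    Fin.snoc_castSucc, Fin.snoc_last, hdesc, Nat.cast_mul]
  field_simp

theorem multinom_mul_mvKrawtchouk {ℓ : ℕ} (n : Fin ℓ → ℕ) {x : Fin ℓ → ℕ} (p : Fin ℓ → ℝ) {N : ℕ}
    (hx : ∑ r, x r ≤ N) :
    multinom N n * mvKrawtchouk n x p N = mvKrawtchoukCoeff n x p N := by
  rcases lt_or_ge N (∑ r, n r) with hn | hn
  · rw [mvKrawtchoukCoeff_eq_zero_of_lt p hx hn, multinom, if_neg hn.not_ge, zero_mul]
  have hdesc : (N.descFactorial (∑ r, n r) : ℝ) ≠ 0 :=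
    Nat.cast_ne_zero.2 (Nat.descFactorial_pos.2 hn).ne'
  have hsign : (-1 : ℝ) ^ (∑ r, n r) * (-1) ^ (∑ r, n r) = 1 :=
    pow_mul_pow_eq_one _ (by norm_num)
  simp only [mvKrawtchouk, mvKrawtchoukCoeff, krawtchoukCoeff, poch_neg_natCast (a := N),
    multinom_eq_descFactorial_div]
  rw [Finset.prod_mul_distrib (f := fun r => (-1 : ℝ) ^ n r / ((n r).factorial : ℝ)),
    Finset.prod_div_distrib, Finset.prod_pow_eq_pow_sum, ← mul_assoc]
  congr 1
  have hfac : ∏ r, ((n r).factorial : ℝ) ≠ 0 :=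
    Finset.prod_ne_zero_iff.2 fun r _ => Nat.cast_ne_zero.2 (Nat.factorial_ne_zero _)
  field_simp
  linear_combination -hsign

theorem mvKrawtchoukCoeff_change_param_zero {ℓ : ℕ} [NeZero ℓ] {x : Fin ℓ → ℕ} {N : ℕ}
    (hx : ∑ r, x r ≤ N) {p : Fin ℓ → ℝ} (hp : p 0 ≠ 0) {a : ℝ} (ha : a = 0 → x 0 = 0)
    (n : Fin ℓ → ℕ) :
    mvKrawtchoukCoeff n x p N = ∑ z ∈ Finset.range (n 0 + 1),
      (a / p 0) ^ (n 0 - z) * (1 - a / p 0) ^ z *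
        ((N - ∑ r, (n - e0 z : Fin ℓ → ℕ) r).choose z *
          mvKrawtchoukCoeff (n - e0 z) x (Function.update p 0 a) N) := by
  obtain _ | ℓ := ℓ
  · exact (NeZero.ne 0 rfl).elim
  have htail (z : ℕ) : Fin.tail (n - e0 z : Fin (ℓ + 1) → ℕ) = Fin.tail n := by
    ext r
    simp [Fin.tail, e0]
  have hhead (z : ℕ) : (n - e0 z : Fin (ℓ + 1) → ℕ) 0 = n 0 - z := by simp [e0]
  have hp_tail : Fin.tail (Function.update p 0 a) = Fin.tail p := Fin.tail_update_zero p a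
  simp only [mvKrawtchoukCoeff_succ_of_sum_le _ _ hx, sum_eq_head_add_sum_tail (n - e0 _), htail,
    hhead, hp_tail, Function.update_self]
  rw [sum_eq_head_add_sum_tail] at hx
  rcases lt_or_ge (N - x 0) (∑ r, Fin.tail n r) with hn | hn
  · simp only [mvKrawtchoukCoeff_eq_zero_of_lt _ (le_tsub_of_add_le_left hx) hn, mul_zero,
      Finset.sum_const_zero]
  rw [krawtchoukCoeff_change_param (by omega) hp ha, ← Finset.sum_range_reflect, Finset.sum_mul]
  refine Finset.sum_congr rfl fun z hz => ?_
  have hz := Finset.mem_range_succ_iff.1 hz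
  rw [show n 0 + 1 - 1 - z = n 0 - z by omega, show n 0 - (n 0 - z) = z by omega,
    show N - (n 0 - z + ∑ r, Fin.tail n r) = N - ∑ r, Fin.tail n r - (n 0 - z) by omega]
  ring

theorem pi_single_le_iff {ι : Type*} [DecidableEq ι] {i : ι} {z : ℕ} {m : ι → ℕ} :
    Pi.single i z ≤ m ↔ z ≤ m i := by
  rw [Pi.single, update_le_iff]
  exact and_iff_left fun _ _ => Nat.zero_le _

theorem sum_Iic_sum_range_single {ι M : Type*} [Fintype ι] [DecidableEq ι] [AddCommMonoid M]
    (n : ι → ℕ) (i : ι) (f : (ι → ℕ) → ℕ → M) :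
    ∑ m ∈ Finset.Iic n, ∑ z ∈ Finset.range ((n - m) i + 1), f m z =
      ∑ α ∈ Finset.Iic n, ∑ z ∈ Finset.range (α i + 1), f (α - Pi.single i z) z := by
  rw [Finset.sum_sigma', Finset.sum_sigma']
  refine Finset.sum_nbij' (fun a => ⟨a.1 + Pi.single i a.2, a.2⟩)
    (fun a => ⟨a.1 - Pi.single i a.2, a.2⟩) ?_ ?_ ?_ ?_ ?_ <;>
  rintro ⟨m, z⟩ hmz <;>
  simp only [Finset.mem_sigma, Finset.mem_Iic, Finset.mem_range_succ_iff, ← pi_single_le_iff]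
    at hmz ⊢
  · exact ⟨add_le_of_le_tsub_left_of_le hmz.1 hmz.2, le_add_self⟩
  · have hsub : m - Pi.single i z ≤ n := tsub_le_self.trans hmz.1
    exact ⟨hsub, (le_tsub_iff_left hsub).2 ((tsub_add_cancel_of_le hmz.2).trans_le hmz.1)⟩
  · rw [add_tsub_cancel_right]
  · rw [tsub_add_cancel_of_le hmz.2]
  · rw [add_tsub_cancel_right]

theorem mvKrawtchoukCoeff_add_change_param_zero {ℓ : ℕ} [NeZero ℓ] {x y : Fin ℓ → ℕ} {M N : ℕ}
    (hx : ∑ r, x r ≤ M) (hy : ∑ r, y r ≤ N) {p : Fin ℓ → ℝ} (hp : p 0 ≠ 0) {a : ℝ}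
    (ha : a = 0 → y 0 = 0) (n : Fin ℓ → ℕ) :
    mvKrawtchoukCoeff n (x + y) p (M + N) =
      ∑ α ∈ Finset.Iic n, ∑ z ∈ Finset.range (α 0 + 1),
        (a / p 0) ^ (n 0 - α 0) * (1 - a / p 0) ^ z *
          ((N - ∑ r, (n - α) r).choose z * mvKrawtchoukCoeff (α - e0 z) x p M *
            mvKrawtchoukCoeff (n - α) y (Function.update p 0 a) N) := by
  rw [← mvKrawtchoukCoeff_add hx hy]
  simp only [mvKrawtchoukCoeff_change_param_zero hy hp ha, Finset.mul_sum]
  rw [sum_Iic_sum_range_single n 0]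
  refine Finset.sum_congr rfl fun α _ => Finset.sum_congr rfl fun z hz => ?_
  have hz := Finset.mem_range_succ_iff.1 hz
  have hsub : n - (α - Pi.single 0 z) - Pi.single 0 z = n - α := by
    rw [tsub_tsub, tsub_add_cancel_of_le (pi_single_le_iff.2 hz)]
  have hsub_zero : (n - (α - Pi.single 0 z) : Fin ℓ → ℕ) 0 - z = n 0 - α 0 := by
    simpa only [Pi.sub_apply, Pi.single_eq_same] using congrFun hsub 0
  simp only [e0]
  rw [hsub, hsub_zero]
  ring

theorem filter_X_le_eq_Iic {ℓ N : ℕ} {n : Fin ℓ → ℕ} (hn : ∑ r, n r ≤ N) :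
    (X ℓ N).filter (fun α => ∀ r, α r ≤ n r) = Finset.Iic n := by
  ext α
  simp only [Finset.mem_filter, mem_X, Finset.mem_Iic, Pi.le_def, and_iff_right_iff_imp]
  exact fun h => (Finset.sum_le_sum fun r _ => h r).trans hn

theorem mainTheorem1_general (ℓ : ℕ) [NeZero ℓ] (N : ℕ) (p : Fin ℓ → ℝ) (hp : p 0 ≠ 0) (a : ℝ)
    (n : Fin ℓ → ℕ) (hn : n ∈ X ℓ N) (t : ℕ) (u : Fin ℓ → ℕ) (hu : u ∈ X ℓ N) (htu : t ≤ u 0)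
    (y : Fin ℓ → ℕ) (hy : y ∈ X ℓ t) (ha : a = 0 → y 0 = 0) :
    mvKrawtchouk n (u + y - e0 t) p N =
      1 / multinom N n *
        ∑ α ∈ (X ℓ N).filter (fun α => ∀ r, α r ≤ n r), ∑ z ∈ Finset.range (α 0 + 1),
          (a / p 0) ^ (n 0 - α 0) * (1 - a / p 0) ^ z *
            multinom t (Fin.snoc (n - α) z : Fin (ℓ + 1) → ℕ) *
            multinom (N - t) (α - e0 z) *
            mvKrawtchouk (α - e0 z) (u - e0 t) p (N - t) *
            mvKrawtchouk (n - α) y (Function.update p 0 a) t := by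
  rw [mem_X] at hn hu hy
  obtain ⟨v, rfl⟩ : ∃ v, u = e0 t + v := exists_add_of_le (pi_single_le_iff.2 htu)
  have hv : t + ∑ r, v r ≤ N := by simpa [e0, Finset.sum_add_distrib] using hu
  have hvy : ∑ r, (v + y) r ≤ N := by
    simp only [Pi.add_apply, Finset.sum_add_distrib]
    omega
  have hcoeff : mvKrawtchoukCoeff n (v + y) p N = mvKrawtchoukCoeff n (v + y) p (N - t + t) := by
    rw [Nat.sub_add_cancel (by omega)]
  have hv_sub : ∑ r, v r ≤ N - t := le_tsub_of_add_le_left hv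
  rw [one_div, eq_inv_mul_iff_mul_eq₀ (multinom_ne_zero hn), add_assoc, add_tsub_cancel_left,
    add_tsub_cancel_left, multinom_mul_mvKrawtchouk n p hvy, filter_X_le_eq_Iic hn, hcoeff,
    mvKrawtchoukCoeff_add_change_param_zero hv_sub hy hp ha]
  refine Finset.sum_congr rfl fun α _ => Finset.sum_congr rfl fun z _ => ?_
  rw [multinom_snoc, ← multinom_mul_mvKrawtchouk _ _ hv_sub, ← multinom_mul_mvKrawtchouk _ _ hy]
  ring

theorem sub_two_div_sub_one_div_sub_one_div {K : Type*} [Field K] (q : K) :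
    (q - 2) / (q - 1) / ((q - 1) / q) = q * (q - 2) / (q - 1) ^ 2 := by
  rw [div_div_div_eq, sq, mul_comm q]

theorem one_sub_mul_sub_two_div_sq {K : Type*} [Field K] {q : K} (hq : q - 1 ≠ 0) :
    1 - q * (q - 2) / (q - 1) ^ 2 = 1 / (q - 1) ^ 2 := by
  field_simp
  ring

theorem mainTheorem1 (ℓ : ℕ) [NeZero ℓ] (N : ℕ) (q : ℕ) (hq : IsPrimePow q)
    (n : Fin ℓ → ℕ) (hn : n ∈ X ℓ N) (t : ℕ) (ht : t ≤ N)
    (u : Fin ℓ → ℕ) (hu : u ∈ X ℓ N) (htu : t ≤ u 0)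
    (y : Fin ℓ → ℕ) (hy : y ∈ X ℓ t) (hq2 : q = 2 → y 0 = 0) :
    mvKrawtchouk n (u + y - e0 t) (fun _ => ((q : ℝ) - 1) / q) N =
      1 / multinom N n *
        ∑ α ∈ (X ℓ N).filter (fun α => ∀ r, α r ≤ n r), ∑ z ∈ Finset.range (α 0 + 1),
          ((q : ℝ) * ((q : ℝ) - 2) / ((q : ℝ) - 1) ^ 2) ^ (n 0 - α 0) *
            (1 / ((q : ℝ) - 1) ^ (2 * z)) *
            multinom t (Fin.snoc (n - α) z : Fin (ℓ + 1) → ℕ) *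
            multinom (N - t) (α - e0 z) *
            mvKrawtchouk (α - e0 z) (u - e0 t) (fun _ => ((q : ℝ) - 1) / q) (N - t) *
            mvKrawtchouk (n - α) y
              (Function.update (fun _ => ((q : ℝ) - 1) / q) 0 (((q : ℝ) - 2) / ((q : ℝ) - 1))) t := by
  have hq_two : (2 : ℝ) ≤ q := mod_cast hq.two_le
  have hq_pred : (q : ℝ) - 1 ≠ 0 := by linarith
  have hp : ((q : ℝ) - 1) / q ≠ 0 := div_ne_zero hq_pred (by linarith)
  have ha : ((q : ℝ) - 2) / (q - 1) = 0 → y 0 = 0 := fun h =>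
    hq2 (by exact_mod_cast sub_eq_zero.1 ((div_eq_zero_iff.1 h).resolve_right hq_pred))
  rw [mainTheorem1_general ℓ N (fun _ => ((q : ℝ) - 1) / q) hp _ n hn t u hu htu y hy ha]
  simp only [sub_two_div_sub_one_div_sub_one_div, one_sub_mul_sub_two_div_sq hq_pred, one_div,
    inv_pow, ← pow_mul]
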